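/- Let $0<\alpha<1$, $B\ge 1$, $L_0>0$, and $L_j=(B+1)L_{j-1}$ for $j=1,\dots,J$. For $t\ge 0$ and $1\le j\le J$ put $\Delta L_j=L_j-L_{j-1}$ and $$I_j=\frac1{\Gamma(1-\alpha)}\int_{L_{j-1}}^{L_j}x^{-\alpha}e^{-xt}\,dx=\int_{-1}^1 f_j(y)\,dy,$$ $$f_j(y)=\frac{\Delta L_j}{2\Gamma(1-\alpha)}\,e^{-L_{j-1}t}\Bigl(L_{j-1}+\tfrac{\Delta L_j}{2}(y+1)\Bigr)^{-\alpha}e^{-t(y+1)\Delta L_j/2}.$$ For $Q\ge1$ let $I_Qf_j=\sum_{i=1}^Q w_if_j(x_i)$ be the $Q$-point Gauss(-Legendre) quadrature of $f_j$ on $[-1,1]$ (the nodes $x_i$ are the zeros of the Legendre polynomial of degree $Q$, and $w_i$ is the integral over $[-1,1]$ of the corresponding Lagrange basis polynomial), and let $\tau_j(Q)=\int_{-1}^1 f_j(y)\,dy-I_Qf_j$ be its error. Then $$|\tau_j(Q)|\le\frac{4B\,L_{j-1}^{1-\alpha}}{\Gamma(1-\alpha)}\min_{0<\varepsilon<1}\frac{g(\varepsilon,B)^{-2Q+1}}{g(\varepsilon,B)-1}\,\varepsilon^{-\alpha}e^{-tL_{j-1}\varepsilon},$$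 where the minimum is attained and $$g(\varepsilon,B)=1+\frac2B(1-\varepsilon)+\sqrt{\Bigl(1+\frac2B(1-\varepsilon)\Bigr)^2-1}.$$ -/

import Mathlib

namespace GaussLegendre

/-- The Legendre polynomial of degree `Q` (Rodrigues' formula). -/
noncomputable def legendre (Q : ℕ) : Polynomial ℝ :=
  Polynomial.C (1 / ((2 : ℝ) ^ Q * (Nat.factorial Q : ℝ))) *
    Polynomial.derivative^[Q] ((Polynomial.X ^ 2 - 1) ^ Q)

/-- The nodes of the `Q`-point Gauss rule on `[-1, 1]` for the weight `w ≡ 1`: the zeros of the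
Legendre polynomial of degree `Q`. -/
noncomputable def nodes (Q : ℕ) : Finset ℝ :=
  (legendre Q).roots.toFinset

/-- The weight of the `Q`-point Gauss rule at the node `x`: the integral over `[-1, 1]` of the
Lagrange basis polynomial which is `1` at `x` and `0` at the other nodes. -/
noncomputable def weight (Q : ℕ) (x : ℝ) : ℝ :=
  ∫ y in (-1 : ℝ)..1, (Lagrange.basis (nodes Q) id x).eval y

/-- The `Q`-point Gauss quadrature `I_Q f` on `[-1, 1]` (weight function `w ≡ 1`). -/
noncomputable def quad (Q : ℕ) (f : ℝ → ℝ) : ℝ :=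
  ∑ x ∈ nodes Q, weight Q x * f x

/-- The quadrature error `I f - I_Q f`, where `I f` is the integral of `f` over `[-1, 1]`. -/
noncomputable def error (Q : ℕ) (f : ℝ → ℝ) : ℝ :=
  (∫ y in (-1 : ℝ)..1, f y) - quad Q f

end GaussLegendre

/-- The integral `(1 / Γ(1 - α)) ∫_a^b x ^ (-α) e ^ (-x t) dx`. -/
noncomputable def kernelIntegral (α t a b : ℝ) : ℝ :=
  1 / Real.Gamma (1 - α) * ∫ x in a..b, x ^ (-α) * Real.exp (-x * t)

/-- The integrand of `kernelIntegral α t a b` (with its constant factor) after the affine change of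
variables `x = a + (b - a) / 2 * (y + 1)` to the reference interval `[-1, 1]`. -/
noncomputable def referenceIntegrand (α t a b y : ℝ) : ℝ :=
  (b - a) / (2 * Real.Gamma (1 - α)) * Real.exp (-a * t) *
    (a + (b - a) / 2 * (y + 1)) ^ (-α) * Real.exp (-t * (y + 1) * (b - a) / 2)

/-- `g(ε, B) = 1 + (2 / B) (1 - ε) + √((1 + (2 / B) (1 - ε))² - 1)`. -/
noncomputable def gFun (ε B : ℝ) : ℝ :=
  1 + 2 / B * (1 - ε) + Real.sqrt ((1 + 2 / B * (1 - ε)) ^ 2 - 1)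

/-- The quantity minimised over `0 < ε < 1` in the error bound; `l` is the left endpoint of the
integration interval. -/
noncomputable def errorFactor (α B t l : ℝ) (Q : ℕ) (ε : ℝ) : ℝ :=
  gFun ε B ^ (-2 * (Q : ℤ) + 1) / (gFun ε B - 1) * ε ^ (-α) * Real.exp (-t * l * ε)

/-!
A Gauss rule has positive weights of sum at most `2`, nodes in `[-1, 1]`, and integrates polynomials
of degree `< 2 * Q` exactly. Hence its error functional `E` kills the Chebyshev polynomials `T k`
with `k < 2 * Q` and is at most `4` on the others, so that
`|E (T k)| ≤ 8 * exp (-2 * Q * θ) * T k (cosh θ)` for all `k` and `θ`.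
An inequality `|E f| ≤ C * f (cosh θ)` is preserved by sums and nonnegative multiples, and monomials
are nonnegative combinations of Chebyshev polynomials. It therefore passes to power series with
nonnegative coefficients. The function `y ↦ f (-y)` is such a series for the integrand `f`, being a
product of a negative power of a positive affine function and a decreasing exponential. With
`exp θ = g(ε, B)`, the point `-cosh θ` corresponds to `x = ε * L_{j-1}` in the original integral,
which is where the factor `ε ^ (-α) * exp (-t * L_{j-1} * ε)` comes from.
-/

open Polynomial MeasureTheory
open Finset.HasAntidiagonal (antidiagonal mem_antidiagonal)
open scoped Nat

namespace GaussLegendre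

/-- The `k`-th derivative of `(X² - 1) ^ Q`. Rodrigues' formula makes `rodrigues Q Q` a nonzero
multiple of the Legendre polynomial; the lower derivatives carry the induction on `k`. -/
noncomputable def rodrigues (Q k : ℕ) : ℝ[X] :=
  derivative^[k] ((X ^ 2 - 1) ^ Q)

theorem rodrigues_succ (Q k : ℕ) : rodrigues Q (k + 1) = derivative (rodrigues Q k) :=
  Function.iterate_succ_apply' _ _ _

theorem natDegree_rodrigues (Q k : ℕ) : (rodrigues Q k).natDegree = 2 * Q - k := by
  induction k with
  | zero =>
    rw [rodrigues, Function.iterate_zero_apply, natDegree_pow, ← C_1, natDegree_X_pow_sub_C]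
    lia
  | succ k ih =>
    rw [rodrigues_succ, natDegree_derivative, ih]
    lia

theorem rodrigues_ne_zero {Q k : ℕ} (hk : k ≤ Q) : rodrigues Q k ≠ 0 := by
  rcases Q.eq_zero_or_pos with rfl | hQ
  · simp [rodrigues, Nat.le_zero.1 hk]
  · refine ne_zero_of_natDegree_gt (n := 0) ?_
    rw [natDegree_rodrigues]
    lia

theorem eval_rodrigues_of_sq_eq_one {Q k : ℕ} (hk : k < Q) {x : ℝ} (hx : x ^ 2 = 1) :
    (rodrigues Q k).eval x = 0 := by
  refine eval_eq_zero_of_dvd_of_eval_eq_zero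
    (pow_sub_dvd_iterate_derivative_pow (X ^ 2 - 1 : ℝ[X]) Q k) ?_
  simp [hx, (Nat.sub_pos_of_lt hk).ne']

theorem le_card_roots_rodrigues_sdiff_endpoints {Q k : ℕ} (hk : k ≤ Q) :
    k ≤ ((rodrigues Q k).roots.toFinset \ {1, -1}).card := by
  induction k with
  | zero => exact Nat.zero_le _
  | succ k ih =>
    have hends : ({1, -1} : Finset ℝ) ⊆ (rodrigues Q k).roots.toFinset := by
      intro x hx
      rw [Multiset.mem_toFinset, mem_roots (rodrigues_ne_zero (by lia))]
      refine eval_rodrigues_of_sq_eq_one hk ?_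
      rcases (by simpa using hx : x = 1 ∨ x = -1) with rfl | rfl <;> norm_num
    have hcard : (rodrigues Q k).roots.toFinset.card =
        ((rodrigues Q k).roots.toFinset \ {1, -1}).card + 2 := by
      rw [← Finset.card_sdiff_add_card_eq_card hends, Finset.card_pair (by norm_num)]
    have hrolle :=
      card_roots_toFinset_le_card_roots_derivative_sdiff_roots_succ (rodrigues Q k)
    rw [← rodrigues_succ] at hrolle
    have hmono := Finset.card_le_card
      (Finset.sdiff_subset_sdiff (Finset.Subset.refl (rodrigues Q (k + 1)).roots.toFinset) hends)
    have := ih (by lia)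
    lia

theorem integral_rodrigues_mul_eq_zero {Q k : ℕ} (hk : k ≤ Q) {q : ℝ[X]} (hq : q.degree < k) :
    ∫ y in (-1 : ℝ)..1, (rodrigues Q k).eval y * q.eval y = 0 := by
  induction k generalizing q with
  | zero =>
    have : q = 0 := degree_eq_bot.1 (Nat.WithBot.lt_zero_iff.1 hq)
    simp [this]
  | succ k ih =>
    have hq' : (derivative q).degree < k := by
      rw [degree_lt_iff_coeff_zero] at hq ⊢
      intro m hm
      rw [coeff_derivative, hq (m + 1) (by lia), zero_mul]
    have hparts := intervalIntegral.integral_mul_deriv_eq_deriv_mul (a := (-1 : ℝ)) (b := 1)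
      (fun y _ => q.hasDerivAt y) (fun y _ => (rodrigues Q k).hasDerivAt y)
      ((derivative q).continuous.intervalIntegrable _ _)
      ((derivative (rodrigues Q k)).continuous.intervalIntegrable _ _)
    have hinner := ih (by lia) hq'
    simp only [mul_comm (eval _ (rodrigues Q k))] at hinner
    simp only [rodrigues_succ, mul_comm (eval _ (derivative (rodrigues Q k)))]
    rw [hparts, hinner, eval_rodrigues_of_sq_eq_one hk (by norm_num),
      eval_rodrigues_of_sq_eq_one hk (by norm_num)]
    ring

theorem legendre_scale_ne_zero (Q : ℕ) : 1 / ((2 : ℝ) ^ Q * Q !) ≠ 0 := by positivity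

theorem legendre_ne_zero (Q : ℕ) : legendre Q ≠ 0 :=
  mul_ne_zero (C_ne_zero.2 (legendre_scale_ne_zero Q)) (rodrigues_ne_zero le_rfl)

theorem roots_legendre (Q : ℕ) : (legendre Q).roots = (rodrigues Q Q).roots :=
  roots_C_mul _ (legendre_scale_ne_zero Q)

theorem natDegree_legendre (Q : ℕ) : (legendre Q).natDegree = Q := by
  have h := natDegree_C_mul (p := rodrigues Q Q) (legendre_scale_ne_zero Q)
  rw [natDegree_rodrigues] at h
  exact h.trans (by lia)

theorem degree_legendre (Q : ℕ) : (legendre Q).degree = Q := by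
  rw [degree_eq_natDegree (legendre_ne_zero Q), natDegree_legendre]

theorem integral_legendre_mul_eq_zero {Q : ℕ} {q : ℝ[X]} (hq : q.degree < Q) :
    ∫ y in (-1 : ℝ)..1, (legendre Q * q).eval y = 0 := by
  have h := integral_rodrigues_mul_eq_zero le_rfl hq
  simp only [rodrigues] at h
  simp only [legendre, eval_mul, eval_C, mul_assoc, intervalIntegral.integral_const_mul, h,
    mul_zero]

theorem eval_legendre_of_mem_nodes {Q : ℕ} {x : ℝ} (hx : x ∈ nodes Q) : (legendre Q).eval x = 0 :=
  isRoot_of_mem_roots (Multiset.mem_toFinset.1 hx)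

theorem card_nodes (Q : ℕ) : (nodes Q).card = Q := by
  refine le_antisymm ?_ ?_
  · calc (nodes Q).card ≤ (legendre Q).natDegree :=
          (Multiset.toFinset_card_le _).trans (card_roots' _)
      _ = Q := natDegree_legendre Q
  · calc Q ≤ ((rodrigues Q Q).roots.toFinset \ {1, -1}).card :=
          le_card_roots_rodrigues_sdiff_endpoints le_rfl
      _ ≤ (rodrigues Q Q).roots.toFinset.card := Finset.card_le_card Finset.sdiff_subset
      _ = (nodes Q).card := by rw [nodes, roots_legendre]

theorem quad_eval_of_degree_lt {Q : ℕ} {p : ℝ[X]} (hp : p.degree < Q) :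
    quad Q (p.eval ·) = ∫ y in (-1 : ℝ)..1, p.eval y := by
  have hinterp := Lagrange.eq_interpolate (s := nodes Q) (v := id) (f := p)
    Function.injective_id.injOn (by rwa [card_nodes])
  conv_rhs => rw [hinterp]
  simp only [Lagrange.interpolate_apply, eval_finsetSum, eval_mul, eval_C, id]
  rw [intervalIntegral.integral_finsetSum
    fun x _ => (by fun_prop : Continuous _).intervalIntegrable _ _]
  simp only [quad, weight, intervalIntegral.integral_const_mul, mul_comm]

theorem quad_eval_of_degree_lt_two_mul {Q : ℕ} {p : ℝ[X]} (hp : p.degree < (2 * Q : ℕ)) :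
    quad Q (p.eval ·) = ∫ y in (-1 : ℝ)..1, p.eval y := by
  set q := p / legendre Q
  set r := p % legendre Q
  have hdiv : legendre Q * q + r = p := EuclideanDomain.div_add_mod p (legendre Q)
  have hr : r.degree < Q := degree_legendre Q ▸ degree_mod_lt p (legendre_ne_zero Q)
  have hq : q.degree < Q := by
    have hprod : (legendre Q * q).degree < (2 * Q : ℕ) := by
      rw [eq_sub_of_add_eq hdiv]
      exact (degree_sub_le _ _).trans_lt (max_lt hp (hr.trans_le (by norm_cast; lia)))
    rw [degree_mul, degree_legendre, two_mul, Nat.cast_add] at hprod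
    exact lt_of_add_lt_add_left hprod
  have hquad : quad Q (p.eval ·) = quad Q (r.eval ·) :=
    Finset.sum_congr rfl fun x hx => by
      simp only [← hdiv, eval_add, eval_mul, eval_legendre_of_mem_nodes hx, zero_mul, zero_add]
  have hint : ∫ y in (-1 : ℝ)..1, p.eval y = ∫ y in (-1 : ℝ)..1, r.eval y := by
    simp only [← hdiv, eval_add]
    rw [intervalIntegral.integral_add ((legendre Q * q).continuous.intervalIntegrable _ _)
      (r.continuous.intervalIntegrable _ _), integral_legendre_mul_eq_zero hq, zero_add]
  rw [hquad, hint, quad_eval_of_degree_lt hr]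

theorem error_eval_eq_zero {Q : ℕ} {p : ℝ[X]} (hp : p.degree < (2 * Q : ℕ)) :
    error Q (p.eval ·) = 0 := by
  rw [error, quad_eval_of_degree_lt_two_mul hp, sub_self]

/- The squared Lagrange basis polynomial at a node, as a density on `[-1, 1]`, has mass `weight Q x`
and centre of mass `x`: hence the weights are positive and the nodes lie in `[-1, 1]`. -/
theorem integral_sq_basis_mul {Q : ℕ} {x : ℝ} (hx : x ∈ nodes Q) {q : ℝ[X]}
    (hq : q.natDegree ≤ 1) :
    ∫ y in (-1 : ℝ)..1, (Lagrange.basis (nodes Q) id x).eval y ^ 2 * q.eval y =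
      weight Q x * q.eval x := by
  set b := Lagrange.basis (nodes Q) id x
  have hQ : 0 < Q := card_nodes Q ▸ Finset.card_pos.2 ⟨x, hx⟩
  have hb : b.natDegree = Q - 1 := by
    rw [natDegree_eq_of_degree_eq_some (Lagrange.degree_basis Function.injective_id.injOn hx),
      card_nodes]
  have hdeg : (b ^ 2 * q).natDegree < 2 * Q :=
    calc (b ^ 2 * q).natDegree ≤ 2 * b.natDegree + q.natDegree :=
          natDegree_mul_le.trans (by gcongr; exact natDegree_pow_le)
      _ < 2 * Q := by lia
  have hexact := quad_eval_of_degree_lt_two_mul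
    (degree_le_natDegree.trans_lt (by exact_mod_cast hdeg))
  simp only [eval_mul, eval_pow] at hexact
  rw [← hexact, quad, Finset.sum_eq_single_of_mem x hx]
  · have : b.eval x = 1 := Lagrange.eval_basis_self (v := id) Function.injective_id.injOn hx
    simp [this]
  · intro y hy hyx
    have : b.eval y = 0 := Lagrange.eval_basis_of_ne (v := id) hyx.symm hy
    simp [this]

theorem integral_sq_eval_pos {p : ℝ[X]} (hp : p ≠ 0) {a b : ℝ} (hab : a < b) :
    0 < ∫ y in a..b, p.eval y ^ 2 := by
  obtain ⟨c, hc, hpc⟩ : ∃ c ∈ Set.Icc a b, p.eval c ≠ 0 := by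
    by_contra! h
    exact hp (eq_zero_of_infinite_isRoot p ((Set.Icc_infinite hab).mono h))
  exact intervalIntegral.integral_pos hab (by fun_prop) (fun _ _ => sq_nonneg _)
    ⟨c, hc, by positivity⟩

theorem weight_pos {Q : ℕ} {x : ℝ} (hx : x ∈ nodes Q) : 0 < weight Q x := by
  have h := integral_sq_basis_mul hx (q := 1) (by simp)
  simp only [eval_one, mul_one] at h
  rw [← h]
  exact integral_sq_eval_pos (Lagrange.basis_ne_zero Function.injective_id.injOn hx) (by norm_num)

theorem node_mem_Icc {Q : ℕ} {x : ℝ} (hx : x ∈ nodes Q) : x ∈ Set.Icc (-1 : ℝ) 1 := by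
  have heval_nonneg (q : ℝ[X]) (hdeg : q.natDegree ≤ 1)
      (hq : ∀ y ∈ Set.Icc (-1 : ℝ) 1, 0 ≤ q.eval y) : 0 ≤ q.eval x := by
    refine nonneg_of_mul_nonneg_right ?_ (weight_pos hx)
    rw [← integral_sq_basis_mul hx hdeg]
    exact intervalIntegral.integral_nonneg (by norm_num)
      fun y hy => mul_nonneg (sq_nonneg _) (hq y hy)
  constructor
  · have := heval_nonneg (X + C 1) (by compute_degree) fun y hy => by
      simpa only [eval_add, eval_X, eval_C] using neg_le_iff_add_nonneg.1 hy.1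
    simpa only [eval_add, eval_X, eval_C, neg_le_iff_add_nonneg] using this
  · have := heval_nonneg (C 1 - X) (by compute_degree) fun y hy => by
      simpa only [eval_sub, eval_X, eval_C] using sub_nonneg.2 hy.2
    simpa only [eval_sub, eval_X, eval_C, sub_nonneg] using this

theorem sum_weight_le (Q : ℕ) : ∑ x ∈ nodes Q, weight Q x ≤ 2 := by
  rcases Q.eq_zero_or_pos with rfl | hQ
  · simp [Finset.card_eq_zero.1 (card_nodes 0)]
  · have h := quad_eval_of_degree_lt (p := 1) (degree_one_le.trans_lt (by exact_mod_cast hQ))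
    simp only [quad, eval_one, mul_one, integral_one] at h
    linarith

theorem abs_quad_le (Q : ℕ) {f : ℝ → ℝ} {C : ℝ} (hC : 0 ≤ C)
    (hf : ∀ y ∈ Set.Icc (-1 : ℝ) 1, |f y| ≤ C) : |quad Q f| ≤ 2 * C :=
  calc |quad Q f| ≤ ∑ x ∈ nodes Q, |weight Q x * f x| := Finset.abs_sum_le_sum_abs _ _
    _ ≤ ∑ x ∈ nodes Q, weight Q x * C := Finset.sum_le_sum fun x hx => by
        rw [abs_mul, abs_of_pos (weight_pos hx)]
        exact mul_le_mul_of_nonneg_left (hf x (node_mem_Icc hx)) (weight_pos hx).le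
    _ ≤ 2 * C := by
        rw [← Finset.sum_mul]
        exact mul_le_mul_of_nonneg_right (sum_weight_le Q) hC

theorem abs_error_le (Q : ℕ) {f : ℝ → ℝ} {C : ℝ} (hf : ∀ y ∈ Set.Icc (-1 : ℝ) 1, |f y| ≤ C) :
    |error Q f| ≤ 4 * C := by
  have hint : ‖∫ y in (-1 : ℝ)..1, f y‖ ≤ C * |1 - (-1)| :=
    intervalIntegral.norm_integral_le_of_norm_le_const fun y hy =>
      hf y (Set.Ioc_subset_Icc_self (Set.uIoc_of_le (by norm_num : (-1 : ℝ) ≤ 1) ▸ hy))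
  have hquad := abs_quad_le Q ((abs_nonneg _).trans (hf 0 (by norm_num))) hf
  calc |error Q f| ≤ |∫ y in (-1 : ℝ)..1, f y| + |quad Q f| := abs_sub _ _
    _ ≤ C * |1 - (-1)| + 2 * C := add_le_add hint hquad
    _ = 4 * C := by norm_num; ring

theorem error_add {f g : ℝ → ℝ} (hf : IntervalIntegrable f volume (-1) 1)
    (hg : IntervalIntegrable g volume (-1) 1) (Q : ℕ) :
    error Q (fun y => f y + g y) = error Q f + error Q g := by
  simp only [error, quad, mul_add, Finset.sum_add_distrib, intervalIntegral.integral_add hf hg]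
  ring

theorem error_const_mul (Q : ℕ) (c : ℝ) (f : ℝ → ℝ) :
    error Q (fun y => c * f y) = c * error Q f := by
  simp only [error, quad, intervalIntegral.integral_const_mul, mul_sub, Finset.mul_sum,
    mul_left_comm]

open Polynomial.Chebyshev

theorem abs_error_eval_T_le (Q : ℕ) (θ : ℝ) (k : ℤ) :
    |error Q ((T ℝ k).eval ·)| ≤ 8 * Real.exp (-(2 * Q * θ)) * (T ℝ k).eval (Real.cosh θ) := by
  rw [T_real_cosh]
  rcases lt_or_ge k.natAbs (2 * Q) with hk | hk
  · rw [error_eval_eq_zero (by rw [degree_T]; exact_mod_cast hk), abs_zero]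
    exact mul_nonneg (by positivity) (Real.cosh_pos _).le
  · have hT := abs_error_le Q fun y hy => abs_eval_T_real_le_one k (abs_le.2 hy)
    have hgrowth : Real.exp (2 * Q * θ) / 2 ≤ Real.cosh (k * θ) :=
      calc Real.exp (2 * Q * θ) / 2 ≤ Real.cosh (2 * Q * θ) := by
            rw [Real.cosh_eq]
            linarith [Real.exp_pos (-(2 * Q * θ))]
        _ ≤ Real.cosh (k * θ) := by
            rw [Real.cosh_le_cosh, abs_mul _ θ, abs_mul _ θ]
            refine mul_le_mul_of_nonneg_right ?_ (abs_nonneg θ)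
            rw [← Int.cast_abs, Int.abs_eq_natAbs, abs_of_nonneg (by positivity)]
            exact_mod_cast hk
    calc |error Q ((T ℝ k).eval ·)| ≤ 4 * 1 := hT
      _ = 8 * Real.exp (-(2 * Q * θ)) * (Real.exp (2 * Q * θ) / 2) := by
          rw [Real.exp_neg]
          field_simp
          norm_num
      _ ≤ 8 * Real.exp (-(2 * Q * θ)) * Real.cosh (k * θ) := by gcongr

/- Multiplication by `X` maps a Chebyshev polynomial to the mean of its two neighbours, so the bound
is inherited from the Chebyshev polynomials. -/
theorem abs_error_eval_X_pow_mul_T_le (Q : ℕ) (θ : ℝ) (n : ℕ) (k : ℤ) :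
    |error Q ((X ^ n * T ℝ k).eval ·)| ≤
      8 * Real.exp (-(2 * Q * θ)) * (X ^ n * T ℝ k).eval (Real.cosh θ) := by
  induction n generalizing k with
  | zero => simpa only [pow_zero, one_mul] using abs_error_eval_T_le Q θ k
  | succ n ih =>
    have hmean (y : ℝ) : (X ^ (n + 1) * T ℝ k).eval y =
        1 / 2 * ((X ^ n * T ℝ (k + 1)).eval y + (X ^ n * T ℝ (k - 1)).eval y) := by
      simp only [T_add_one, eval_mul, eval_sub, eval_pow, eval_X, eval_ofNat]
      ring
    simp only [hmean]
    rw [error_const_mul, error_add ((Polynomial.continuous _).intervalIntegrable _ _)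
      ((Polynomial.continuous _).intervalIntegrable _ _), abs_mul, abs_of_pos one_half_pos]
    linarith [ih (k + 1), ih (k - 1), abs_add_le (error Q ((X ^ n * T ℝ (k + 1)).eval ·))
      (error Q ((X ^ n * T ℝ (k - 1)).eval ·))]

theorem abs_error_neg_pow_le (Q : ℕ) (θ : ℝ) (n : ℕ) :
    |error Q (fun y => (-y) ^ n)| ≤ 8 * Real.exp (-(2 * Q * θ)) * Real.cosh θ ^ n := by
  have h := abs_error_eval_X_pow_mul_T_le Q θ n 0
  simp only [T_zero, mul_one, eval_pow, eval_X] at h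
  have hneg : (fun y : ℝ => (-y) ^ n) = fun y => (-1) ^ n * y ^ n := funext fun y => neg_pow y n
  rwa [hneg, error_const_mul, abs_mul, abs_neg_one_pow, one_mul]

theorem hasSum_error {ι : Type*} [Countable ι] (Q : ℕ) {F : ι → ℝ → ℝ} {f : ℝ → ℝ} {b : ι → ℝ}
    (hF : ∀ i, AEStronglyMeasurable (F i) (volume.restrict (Set.uIoc (-1) 1)))
    (hb : Summable b)
    (hFb : ∀ i, ∀ y ∈ Set.Icc (-1 : ℝ) 1, |F i y| ≤ b i)
    (hf : ∀ y ∈ Set.Icc (-1 : ℝ) 1, HasSum (F · y) (f y)) :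
    HasSum (fun i => error Q (F i)) (error Q f) := by
  have hsub {y : ℝ} (hy : y ∈ Set.uIoc (-1 : ℝ) 1) : y ∈ Set.Icc (-1 : ℝ) 1 := by
    rw [← Set.uIcc_of_le (by norm_num)]
    exact Set.uIoc_subset_uIcc hy
  have hint : HasSum (fun i => ∫ y in (-1 : ℝ)..1, F i y) (∫ y in (-1 : ℝ)..1, f y) :=
    intervalIntegral.hasSum_integral_of_dominated_convergence (fun i _ => b i) hF
      (fun i => .of_forall fun y hy => hFb i y (hsub hy))
      (.of_forall fun _ _ => hb) intervalIntegrable_const (.of_forall fun y hy => hf y (hsub hy))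
  exact hint.sub (hasSum_sum fun x hx => (hf x (node_mem_Icc hx)).mul_left (weight Q x))

end GaussLegendre

theorem multichoose_nonneg {α : ℝ} (hα : 0 < α) (n : ℕ) : 0 ≤ Ring.multichoose α n := by
  have hpos : 0 < n ! * Ring.multichoose α n := by
    rw [← nsmul_eq_mul, Ring.factorial_nsmul_multichoose_eq_ascPochhammer,
      ascPochhammer_smeval_eq_eval]
    exact ascPochhammer_pos n α hα
  exact (pos_of_mul_pos_right hpos (by positivity)).le

theorem hasSum_one_add_rpow_neg (α : ℝ) {u : ℝ} (hu : |u| < 1) :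
    HasSum (fun n : ℕ => Ring.multichoose α n * (-u) ^ n) ((1 + u) ^ (-α)) := by
  have h := (Real.one_div_one_sub_rpow_hasFPowerSeriesOnBall_zero α).hasSum (y := -u)
    (by simpa [enorm_eq_nnnorm, ← NNReal.coe_lt_coe] using hu)
  rw [Real.rpow_neg (by linarith [neg_abs_le u])]
  simpa [Ring.multichoose_eq, FormalMultilinearSeries.ofScalars_apply_eq, mul_comm] using h

/-- `f` is, on `(-r, r)`, the sum of a power series in `-y` with nonnegative coefficients. Every
completely monotone function on `(-r, ∞)` has this property; the integrand at hand is one. -/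
def HasAlternatingPowerSeries (f : ℝ → ℝ) (r : ℝ) : Prop :=
  ∃ c : ℕ → ℝ, (∀ n, 0 ≤ c n) ∧ ∀ y, |y| < r → HasSum (fun n => c n * (-y) ^ n) (f y)

namespace HasAlternatingPowerSeries

variable {f g : ℝ → ℝ} {r : ℝ}

theorem const_mul (hf : HasAlternatingPowerSeries f r) {K : ℝ} (hK : 0 ≤ K) :
    HasAlternatingPowerSeries (fun y => K * f y) r := by
  obtain ⟨c, hc, hcf⟩ := hf
  refine ⟨fun n => K * c n, fun n => mul_nonneg hK (hc n), fun y hy => ?_⟩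
  simpa only [mul_assoc] using (hcf y hy).mul_left K

theorem mul (hf : HasAlternatingPowerSeries f r) (hg : HasAlternatingPowerSeries g r) :
    HasAlternatingPowerSeries (fun y => f y * g y) r := by
  obtain ⟨c, hc, hcf⟩ := hf
  obtain ⟨d, hd, hdg⟩ := hg
  refine ⟨fun n => ∑ kl ∈ antidiagonal n, c kl.1 * d kl.2,
    fun n => Finset.sum_nonneg fun kl _ => mul_nonneg (hc _) (hd _), fun y hy => ?_⟩
  have hcauchy (n : ℕ) : (∑ kl ∈ antidiagonal n, c kl.1 * d kl.2) * (-y) ^ n =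
      ∑ kl ∈ antidiagonal n, c kl.1 * (-y) ^ kl.1 * (d kl.2 * (-y) ^ kl.2) := by
    rw [Finset.sum_mul]
    refine Finset.sum_congr rfl fun kl hkl => ?_
    rw [← mem_antidiagonal.1 hkl, pow_add]
    ring
  have hcs := (hcf y hy).summable.norm
  have hds := (hdg y hy).summable.norm
  simp only [hcauchy]
  rw [← (hcf y hy).tsum_eq, ← (hdg y hy).tsum_eq,
    tsum_mul_tsum_eq_tsum_sum_antidiagonal_of_summable_norm hcs hds]
  exact (summable_norm_sum_mul_antidiagonal_of_summable_norm hcs hds).of_norm.hasSum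

theorem exp_neg_mul {s : ℝ} (hs : 0 ≤ s) (r : ℝ) :
    HasAlternatingPowerSeries (fun y => Real.exp (-s * y)) r := by
  refine ⟨fun n => s ^ n / n !, fun n => by positivity, fun y _ => ?_⟩
  have h := NormedSpace.expSeries_div_hasSum_exp (-s * y)
  rw [← Real.exp_eq_exp_ℝ] at h
  simpa only [neg_mul_comm, mul_pow, mul_div_right_comm] using h

theorem add_mul_rpow_neg {α p q : ℝ} (hα : 0 < α) (hp : 0 < p) (hq : 0 < q) :
    HasAlternatingPowerSeries (fun y => (p + q * y) ^ (-α)) (p / q) := by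
  refine ⟨fun n => p ^ (-α) * (Ring.multichoose α n * (q / p) ^ n), fun n => ?_, fun y hy => ?_⟩
  · have := multichoose_nonneg hα n
    positivity
  · have hu : |q / p * y| < 1 := by
      rw [abs_mul, abs_of_pos (div_pos hq hp), ← inv_div, inv_mul_lt_one₀ (div_pos hp hq)]
      exact hy
    have hfactor : p + q * y = p * (1 + q / p * y) := by field_simp
    beta_reduce
    rw [hfactor, Real.mul_rpow hp.le (by linarith [neg_abs_le (q / p * y)])]
    simpa only [neg_mul_eq_mul_neg, mul_pow, mul_assoc] using
      (hasSum_one_add_rpow_neg α hu).mul_left (p ^ (-α))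

theorem abs_error_le (hf : HasAlternatingPowerSeries f r) {θ : ℝ} (hθ : Real.cosh θ < r) (Q : ℕ) :
    |GaussLegendre.error Q f| ≤ 8 * Real.exp (-(2 * Q * θ)) * f (-Real.cosh θ) := by
  obtain ⟨c, hc, hcf⟩ := hf
  have hr : 1 < r := (Real.one_le_cosh θ).trans_lt hθ
  have hsum (y : ℝ) (hy : y ∈ Set.Icc (-1 : ℝ) 1) : HasSum (fun n => c n * (-y) ^ n) (f y) :=
    hcf y ((abs_le.2 hy).trans_lt hr)
  have herror : HasSum (fun n => c n * GaussLegendre.error Q (fun y => (-y) ^ n))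
      (GaussLegendre.error Q f) := by
    simp only [← GaussLegendre.error_const_mul]
    refine GaussLegendre.hasSum_error Q (b := c) (fun n => by fun_prop) ?_ (fun n y hy => ?_) hsum
    · simpa only [neg_neg, one_pow, mul_one] using (hsum (-1) (by norm_num)).summable
    · rw [abs_mul, abs_pow, abs_neg, abs_of_nonneg (hc n)]
      exact mul_le_of_le_one_right (hc n) (pow_le_one₀ (abs_nonneg y) (abs_le.2 hy))
  have hvalue : HasSum (fun n => 8 * Real.exp (-(2 * Q * θ)) * (c n * Real.cosh θ ^ n))
      (8 * Real.exp (-(2 * Q * θ)) * f (-Real.cosh θ)) := by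
    have h := hcf (-Real.cosh θ) (by rwa [abs_neg, abs_of_pos (Real.cosh_pos θ)])
    simp only [neg_neg] at h
    exact h.mul_left _
  refine herror.norm_le_of_bounded hvalue fun n => ?_
  rw [Real.norm_eq_abs, abs_mul, abs_of_nonneg (hc n), mul_left_comm]
  exact mul_le_mul_of_nonneg_left (GaussLegendre.abs_error_neg_pow_le Q θ n) (hc n)

end HasAlternatingPowerSeries

theorem referenceIntegrand_eq (α t a b y : ℝ) :
    referenceIntegrand α t a b y = (b - a) / (2 * Real.Gamma (1 - α)) *
      ((a + (b - a) / 2 * (y + 1)) ^ (-α) * Real.exp (-(a + (b - a) / 2 * (y + 1)) * t)) := by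
  have hexp : Real.exp (-(a + (b - a) / 2 * (y + 1)) * t) =
      Real.exp (-a * t) * Real.exp (-t * (y + 1) * (b - a) / 2) := by
    rw [← Real.exp_add]
    ring_nf
  rw [referenceIntegrand, hexp]
  ring

theorem kernelIntegral_eq_integral_referenceIntegrand (α t a b : ℝ) :
    kernelIntegral α t a b = ∫ y in (-1 : ℝ)..1, referenceIntegrand α t a b y := by
  have hsubst := intervalIntegral.mul_integral_comp_add_mul (a := (-1 : ℝ)) (b := 1)
    (f := fun x => x ^ (-α) * Real.exp (-x * t)) ((b - a) / 2) ((a + b) / 2)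
  have hleft : (a + b) / 2 + (b - a) / 2 * -1 = a := by ring
  have hright : (a + b) / 2 + (b - a) / 2 * 1 = b := by ring
  have harg (y : ℝ) : (a + b) / 2 + (b - a) / 2 * y = a + (b - a) / 2 * (y + 1) := by ring
  simp only [hleft, hright, harg] at hsubst
  simp only [referenceIntegrand_eq, intervalIntegral.integral_const_mul, kernelIntegral, ← hsubst]
  ring

theorem hasAlternatingPowerSeries_referenceIntegrand {α t a b : ℝ} (hα₀ : 0 < α) (hα₁ : α < 1)
    (ht : 0 ≤ t) (ha : 0 < a) (hab : a < b) :
    HasAlternatingPowerSeries (referenceIntegrand α t a b) ((a + b) / (b - a)) := by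
  have hq : 0 < (b - a) / 2 := half_pos (sub_pos.2 hab)
  have hsplit (y : ℝ) : referenceIntegrand α t a b y =
      (b - a) / (2 * Real.Gamma (1 - α)) * Real.exp (-((a + b) / 2 * t)) *
        (((a + b) / 2 + (b - a) / 2 * y) ^ (-α) * Real.exp (-((b - a) / 2 * t) * y)) := by
    have harg : a + (b - a) / 2 * (y + 1) = (a + b) / 2 + (b - a) / 2 * y := by ring
    have hexp : Real.exp (-((a + b) / 2 + (b - a) / 2 * y) * t) =
        Real.exp (-((a + b) / 2 * t)) * Real.exp (-((b - a) / 2 * t) * y) := by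
      rw [← Real.exp_add]
      ring_nf
    rw [referenceIntegrand_eq, harg, hexp]
    ring
  have hradius : (a + b) / (b - a) = (a + b) / 2 / ((b - a) / 2) :=
    (div_div_div_cancel_right₀ two_ne_zero _ _).symm
  rw [funext hsplit, hradius]
  refine ((HasAlternatingPowerSeries.add_mul_rpow_neg hα₀ (by linarith) hq).mul
    (.exp_neg_mul (by positivity) _)).const_mul ?_
  have := sub_pos.2 hab
  positivity

section GFun

variable {B ε : ℝ}

theorem gFun_eq_exp_arcosh (hB : 0 < B) (hε : ε ≤ 1) :
    gFun ε B = Real.exp (Real.arcosh (1 + 2 / B * (1 - ε))) := by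
  rw [gFun, Real.exp_arcosh]
  have : 0 ≤ 2 / B * (1 - ε) := mul_nonneg (by positivity) (sub_nonneg.2 hε)
  linarith

theorem one_lt_gFun (hB : 0 < B) (hε : ε < 1) : 1 < gFun ε B := by
  have h : 0 < 2 / B * (1 - ε) := mul_pos (by positivity) (sub_pos.2 hε)
  rw [gFun, add_assoc]
  exact lt_add_of_pos_right 1 (add_pos_of_pos_of_nonneg h (Real.sqrt_nonneg _))

theorem gFun_one (B : ℝ) : gFun 1 B = 1 := by simp [gFun]

theorem continuous_gFun (B : ℝ) : Continuous (gFun · B) := by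
  unfold gFun
  fun_prop

end GFun

theorem zpow_le_zpow_add_one_div_sub_one {ρ : ℝ} (hρ : 1 < ρ) (n : ℤ) :
    ρ ^ n ≤ ρ ^ (n + 1) / (ρ - 1) := by
  have hρ₀ : 0 < ρ := one_pos.trans hρ
  rw [zpow_add_one₀ hρ₀.ne', le_div_iff₀ (sub_pos.2 hρ)]
  exact mul_le_mul_of_nonneg_left (sub_one_lt ρ).le (zpow_pos hρ₀ _).le

theorem referenceIntegrand_neg_one_add {B : ℝ} (hB : B ≠ 0) (α t a ε : ℝ) :
    referenceIntegrand α t a ((B + 1) * a) (-(1 + 2 / B * (1 - ε))) =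
      B * a / (2 * Real.Gamma (1 - α)) * ((a * ε) ^ (-α) * Real.exp (-t * a * ε)) := by
  have hpoint : a + ((B + 1) * a - a) / 2 * (-(1 + 2 / B * (1 - ε)) + 1) = a * ε := by
    field_simp
    ring
  rw [referenceIntegrand_eq, hpoint]
  ring_nf

section ErrorBound

variable {α B t a ε : ℝ}

theorem abs_error_referenceIntegrand_le_zpow_gFun (hα₀ : 0 < α) (hα₁ : α < 1) (hB : 0 < B)
    (ht : 0 ≤ t) (ha : 0 < a) (hε : ε ∈ Set.Ioo (0 : ℝ) 1) (Q : ℕ) :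
    |GaussLegendre.error Q (referenceIntegrand α t a ((B + 1) * a))| ≤
      8 * gFun ε B ^ (-2 * (Q : ℤ)) *
        (B * a / (2 * Real.Gamma (1 - α)) * ((a * ε) ^ (-α) * Real.exp (-t * a * ε))) := by
  set θ := Real.arcosh (1 + 2 / B * (1 - ε))
  have hcosh : Real.cosh θ = 1 + 2 / B * (1 - ε) := by
    refine Real.cosh_arcosh ?_
    have : 0 < 2 / B * (1 - ε) := mul_pos (by positivity) (sub_pos.2 hε.2)
    linarith
  have hradius : Real.cosh θ < (a + (B + 1) * a) / ((B + 1) * a - a) := by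
    have : (a + (B + 1) * a) / ((B + 1) * a - a) = Real.cosh θ + 2 / B * ε := by
      have hlength : (B + 1) * a - a = B * a := by ring
      rw [hcosh, hlength]
      field_simp
      ring
    rw [this]
    exact lt_add_of_pos_right _ (mul_pos (by positivity) hε.1)
  have hpow : gFun ε B ^ (-2 * (Q : ℤ)) = Real.exp (-(2 * Q * θ)) := by
    have hg : gFun ε B = Real.exp θ := gFun_eq_exp_arcosh hB hε.2.le
    rw [hg, ← Real.rpow_intCast, ← Real.exp_mul]
    push_cast
    ring_nf
  rw [hpow, ← referenceIntegrand_neg_one_add hB.ne', ← hcosh]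
  exact (hasAlternatingPowerSeries_referenceIntegrand hα₀ hα₁ ht ha
    (by nlinarith)).abs_error_le hradius Q

theorem abs_error_referenceIntegrand_le_errorFactor (hα₀ : 0 < α) (hα₁ : α < 1) (hB : 0 < B)
    (ht : 0 ≤ t) (ha : 0 < a) (hε : ε ∈ Set.Ioo (0 : ℝ) 1) (Q : ℕ) :
    |GaussLegendre.error Q (referenceIntegrand α t a ((B + 1) * a))| ≤
      4 * B * a ^ (1 - α) / Real.Gamma (1 - α) * errorFactor α B t a Q ε := by
  have hε₀ := hε.1
  calc |GaussLegendre.error Q (referenceIntegrand α t a ((B + 1) * a))|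
      ≤ 8 * gFun ε B ^ (-2 * (Q : ℤ)) *
        (B * a / (2 * Real.Gamma (1 - α)) * ((a * ε) ^ (-α) * Real.exp (-t * a * ε))) :=
        abs_error_referenceIntegrand_le_zpow_gFun hα₀ hα₁ hB ht ha hε Q
    _ ≤ 8 * (gFun ε B ^ (-2 * (Q : ℤ) + 1) / (gFun ε B - 1)) *
        (B * a / (2 * Real.Gamma (1 - α)) * ((a * ε) ^ (-α) * Real.exp (-t * a * ε))) := by
        gcongr
        exact zpow_le_zpow_add_one_div_sub_one (one_lt_gFun hB hε.2) _
    _ = 4 * B * a ^ (1 - α) / Real.Gamma (1 - α) * errorFactor α B t a Q ε := by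
        rw [errorFactor, Real.mul_rpow ha.le hε₀.le, sub_eq_add_neg 1 α, Real.rpow_add ha,
          Real.rpow_one]
        ring

end ErrorBound

theorem exists_isLeast_inv_image_Ioo {X : Type*} [LinearOrder X] [TopologicalSpace X]
    [CompactIccSpace X] [DenselyOrdered X] {a b : X} (hab : a < b) {u : X → ℝ}
    (hu : ContinuousOn u (Set.Icc a b)) (hua : u a = 0) (hub : u b = 0)
    (hpos : ∀ x ∈ Set.Ioo a b, 0 < u x) :
    ∃ m, IsLeast ((fun x => (u x)⁻¹) '' Set.Ioo a b) m := by
  obtain ⟨x, hx, hmax⟩ := isCompact_Icc.exists_isMaxOn (Set.nonempty_Icc.2 hab.le) hu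
  obtain ⟨z, hz⟩ := exists_between hab
  have hux : 0 < u x := (hpos z hz).trans_le (hmax (Set.Ioo_subset_Icc_self hz))
  have hx' : x ∈ Set.Ioo a b :=
    ⟨hx.1.lt_of_ne fun h => hux.ne' (h ▸ hua), hx.2.lt_of_ne fun h => hux.ne' (h ▸ hub)⟩
  refine ⟨_, ⟨x, hx', rfl⟩, ?_⟩
  rintro _ ⟨y, hy, rfl⟩
  exact inv_anti₀ (hpos y hy) (hmax (Set.Ioo_subset_Icc_self hy))

theorem exists_isLeast_errorFactor {α B : ℝ} (hα : 0 < α) (hB : 0 < B) (t l : ℝ) (Q : ℕ) :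
    ∃ m, IsLeast (errorFactor α B t l Q '' Set.Ioo 0 1) m := by
  set u : ℝ → ℝ := fun ε =>
    gFun ε B ^ (2 * (Q : ℤ) - 1) * (gFun ε B - 1) * ε ^ α * Real.exp (t * l * ε) with hu
  have hinv : ∀ ε ∈ Set.Ioo (0 : ℝ) 1, errorFactor α B t l Q ε = (u ε)⁻¹ := fun ε hε => by
    have hzpow : -2 * (Q : ℤ) + 1 = -(2 * (Q : ℤ) - 1) := by ring
    have hexp : -t * l * ε = -(t * l * ε) := by ring
    rw [errorFactor, hu, Real.rpow_neg hε.1.le, hzpow, zpow_neg, hexp, Real.exp_neg]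
    simp only [mul_inv, div_eq_mul_inv]
  have hg : ∀ ε ∈ Set.Icc (0 : ℝ) 1, gFun ε B ≠ 0 := fun ε hε =>
    gFun_eq_exp_arcosh hB hε.2 ▸ Real.exp_ne_zero _
  have hcont : ContinuousOn u (Set.Icc 0 1) :=
    (((((continuous_gFun B).continuousOn.zpow₀ _ fun ε hε => .inl (hg ε hε)).mul
      ((continuous_gFun B).sub continuous_const).continuousOn).mul
      (Real.continuous_rpow_const hα.le).continuousOn).mul (by fun_prop))
  rw [Set.image_congr hinv]
  refine exists_isLeast_inv_image_Ioo one_pos hcont ?_ ?_ fun ε hε => ?_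
  · simp [hu, Real.zero_rpow hα.ne']
  · simp [hu, gFun_one]
  · have hg₁ := one_lt_gFun hB hε.2
    exact mul_pos (mul_pos (mul_pos (zpow_pos (one_pos.trans hg₁) _) (sub_pos.2 hg₁))
      (Real.rpow_pos_of_pos hε.1 α)) (Real.exp_pos _)

theorem pos_of_eq_mul_pred {R : Type*} [Semiring R] [PartialOrder R] [IsStrictOrderedRing R]
    {L : ℕ → R} {c : R} {J : ℕ} (hc : 0 < c) (hL₀ : 0 < L 0)
    (hL : ∀ i, 1 ≤ i → i ≤ J → L i = c * L (i - 1)) {i : ℕ} (hi : i ≤ J) : 0 < L i := by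
  induction i with
  | zero => exact hL₀
  | succ i ih =>
    rw [hL (i + 1) (by lia) hi]
    exact mul_pos hc (ih (by lia))

theorem mainTheorem7_general {α B t a : ℝ} (hα₀ : 0 < α) (hα₁ : α < 1) (hB : 0 < B) (ht : 0 ≤ t)
    (ha : 0 < a) (Q : ℕ) :
    kernelIntegral α t a ((B + 1) * a) =
        ∫ y in (-1 : ℝ)..1, referenceIntegrand α t a ((B + 1) * a) y ∧
      ∃ m : ℝ, IsLeast (errorFactor α B t a Q '' Set.Ioo 0 1) m ∧
        |GaussLegendre.error Q (referenceIntegrand α t a ((B + 1) * a))| ≤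
          4 * B * a ^ (1 - α) / Real.Gamma (1 - α) * m := by
  refine ⟨kernelIntegral_eq_integral_referenceIntegrand α t a _, ?_⟩
  obtain ⟨m, hm⟩ := exists_isLeast_errorFactor hα₀ hB t a Q
  obtain ⟨ε, hε, rfl⟩ := hm.1
  exact ⟨_, hm, abs_error_referenceIntegrand_le_errorFactor hα₀ hα₁ hB ht ha hε Q⟩

theorem mainTheorem7 (α : ℝ) (hα₀ : 0 < α) (hα₁ : α < 1) (B : ℝ) (hB : 1 ≤ B)
    (J : ℕ) (L : ℕ → ℝ) (hL₀ : 0 < L 0)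
    (hL : ∀ i : ℕ, 1 ≤ i → i ≤ J → L i = (B + 1) * L (i - 1))
    (j : ℕ) (hj₁ : 1 ≤ j) (hjJ : j ≤ J) (Q : ℕ) (hQ : 1 ≤ Q) (t : ℝ) (ht : 0 ≤ t) :
    kernelIntegral α t (L (j - 1)) (L j) =
        ∫ y in (-1 : ℝ)..1, referenceIntegrand α t (L (j - 1)) (L j) y ∧
      ∃ m : ℝ, IsLeast (errorFactor α B t (L (j - 1)) Q '' Set.Ioo 0 1) m ∧
        |GaussLegendre.error Q (referenceIntegrand α t (L (j - 1)) (L j))| ≤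
          4 * B * L (j - 1) ^ (1 - α) / Real.Gamma (1 - α) * m := by
  have hB₀ : 0 < B := one_pos.trans_le hB
  rw [hL j hj₁ hjJ]
  exact mainTheorem7_general hα₀ hα₁ hB₀ ht
    (pos_of_eq_mul_pred (by linarith) hL₀ hL ((Nat.sub_le j 1).trans hjJ)) Q
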